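/- Let $d\ge 2$, let $S^{d-1}=\{x\in\mathbb R^d:|x|=1\}$ with $|\cdot|$ the Euclidean norm, and let $f:[0,4]\to\mathbb R$ be non-increasing and convex on $(0,4]$, differentiable on $(0,4)$ with derivative $f'$ convex on $(0,4)$, and such that $\lim_{t\to0^+}f(t)=f(0)$. For a set $\omega\subset S^{d-1}$ of exactly $d+1$ points put $$P_f(\omega)=\min_{x\in S^{d-1}}\sum_{v\in\omega}f(|x-v|^2)$$ (the minimum is attained), and let $\mathcal P_f=\sup\{P_f(\omega):\omega\subset S^{d-1},\ \#\omega=d+1\}$. Regular $d$-simplices inscribed in $S^{d-1}$ exist. If $\omega^*$ is the set of vertices of any regular $d$-simplex inscribed in $S^{d-1}$, then $\#\omega^*=d+1$, $$P_f(\omega)\le P_f(\omega^*)\quad\text{for every }\omega\subset S^{d-1}\text{ with }\#\omega=d+1,$$ and $$\mathcal P_f=P_f(\omega^*)=f(0)+d\cdot f\left(2+\frac2d\right).$$ If moreover $f$ is strictly convex on $(0,4]$, then for every $\omega\subset S^{d-1}$ with $\#\omega=d+1$, the equality $P_f(\omega)=P_f(\omega^*)$ holds if and only if $\omega$ is the set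 of vertices of a regular $d$-simplex inscribed in $S^{d-1}$. -/

import Mathlib

/-- A `(d+1)`-point configuration on the unit sphere `S^{d-1}` of `ℝ^d`: a set of exactly `d + 1`
points of the sphere. -/
def IsSphereConfig (d : ℕ) (ω : Finset (EuclideanSpace ℝ (Fin d))) : Prop :=
  (ω : Set (EuclideanSpace ℝ (Fin d))) ⊆ Metric.sphere 0 1 ∧ ω.card = d + 1

/-- The potential `p_f(x, ω) = ∑_{v ∈ ω} f(|x - v|²)` (Euclidean norm). For `x` and `ω` on the unit
sphere only the values of `f` on `[0, 4]` matter. -/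
noncomputable def potential {d : ℕ} (f : ℝ → ℝ) (ω : Finset (EuclideanSpace ℝ (Fin d)))
    (x : EuclideanSpace ℝ (Fin d)) : ℝ :=
  ∑ v ∈ ω, f (‖x - v‖ ^ 2)

/-- `P_f(ω, S^{d-1})`, the minimum of the potential of `ω` over the sphere. It is written as an
infimum; the theorem asserts that it is attained. -/
noncomputable def minPotential {d : ℕ} (f : ℝ → ℝ)
    (ω : Finset (EuclideanSpace ℝ (Fin d))) : ℝ :=
  sInf (potential f ω '' Metric.sphere 0 1)

/-- The `(d+1)`-point `f`-polarization of `S^{d-1}`: the supremum of `P_f(ω, S^{d-1})` over all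
`(d+1)`-point configurations `ω` on the sphere. -/
noncomputable def spherePolarization (d : ℕ) (f : ℝ → ℝ) : ℝ :=
  sSup {y : ℝ | ∃ ω : Finset (EuclideanSpace ℝ (Fin d)),
    IsSphereConfig d ω ∧ y = minPotential f ω}

/-- `ω` is the set of vertices of a regular `d`-simplex inscribed in `S^{d-1}`. -/
def IsInscribedRegularSimplex (d : ℕ) (ω : Finset (EuclideanSpace ℝ (Fin d))) : Prop :=
  (ω : Set (EuclideanSpace ℝ (Fin d))) ⊆ Metric.sphere 0 1 ∧
    ∃ s : Affine.Simplex ℝ (EuclideanSpace ℝ (Fin d)) d,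
      s.Regular ∧ Set.range s.points = (ω : Set (EuclideanSpace ℝ (Fin d)))

/-! On the sphere `|x - v|² = 2 - 2⟪x, v⟫`, and the common value to be matched is `V = f 0 + d f(2 +
2/d)`, the potential of a regular simplex at one of its vertices.

Lower bound for the simplex: let `q` be the quadratic agreeing with `f` at `0` and, to first order,
at `2 + 2/d`. Convexity of `f'` gives `q ≤ f` on `[0, 4]` (`exists_quadratic_le`). A regular simplex
is a spherical 2-design, so the potential of `q` is constant on the sphere; at a vertex it equals
`V`.

Upper bound for any configuration: if a closed half-space through the origin contains all points,
its outer normal sees potential at most `(d + 1) f 2 ≤ V`. Otherwise the origin is interior to the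
simplex spanned by the points. Scale the outer facet normals so that the facets lie at height `-1`;
with `T j` the height of the vertex opposite facet `j`, the barycentric coordinates of the origin
are `1 / (1 + T j)`. They sum to `1`, so some `T j ≤ d`, and at that unit normal the potential is at
most `V` (`facet_value_le`). Under strict convexity equality forces every `T j = d` and every normal
to be parallel to its vertex, which fixes the Gram matrix. -/

open scoped InnerProductSpace

/-! ### Extending monotonicity, continuity and convexity to the endpoint `0`. -/

section EndpointExtension

variable {f : ℝ → ℝ}

theorem le_apply_zero_of_antitoneOn (hanti : AntitoneOn f (Set.Ioc 0 4))
    (hlim : Filter.Tendsto f (nhdsWithin 0 (Set.Ioi 0)) (nhds (f 0)))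
    {t : ℝ} (ht : t ∈ Set.Ioc (0 : ℝ) 4) : f t ≤ f 0 := by
  refine ge_of_tendsto hlim ?_
  filter_upwards [Ioc_mem_nhdsGT ht.1] with s hs
  exact hanti ⟨hs.1, hs.2.trans ht.2⟩ ht hs.2

theorem antitoneOn_Icc_of_tendsto (hanti : AntitoneOn f (Set.Ioc 0 4))
    (hlim : Filter.Tendsto f (nhdsWithin 0 (Set.Ioi 0)) (nhds (f 0))) :
    AntitoneOn f (Set.Icc 0 4) := by
  intro s hs t ht hst
  rcases hs.1.eq_or_lt with h0 | h0
  · rcases ht.1.eq_or_lt with h1 | h1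
    · rw [← h0, ← h1]
    · rw [← h0]
      exact le_apply_zero_of_antitoneOn hanti hlim ⟨h1, ht.2⟩
  · exact hanti ⟨h0, hs.2⟩ ⟨h0.trans_le hst, ht.2⟩ hst

/-- The midpoint value is at least `f t` by monotonicity and strictly below the mean of `f s` and `f
t`. For `s = 0`, where convexity is not assumed, the comparison passes through `t / 2`. -/
theorem strictAntiOn_Icc_of_tendsto (hanti : AntitoneOn f (Set.Ioc 0 4))
    (hstrict : StrictConvexOn ℝ (Set.Ioc 0 4) f)
    (hlim : Filter.Tendsto f (nhdsWithin 0 (Set.Ioi 0)) (nhds (f 0))) :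
    StrictAntiOn f (Set.Icc 0 4) := by
  have key : ∀ s t : ℝ, 0 < s → t ≤ 4 → s < t → f t < f s := by
    intro s t hs ht hst
    have h1 := hstrict.2 (show s ∈ Set.Ioc (0 : ℝ) 4 from ⟨hs, by linarith⟩)
      (show t ∈ Set.Ioc (0 : ℝ) 4 from ⟨by linarith, ht⟩) hst.ne
      (one_half_pos (α := ℝ)) (one_half_pos (α := ℝ)) (by norm_num)
    have h2 : f t ≤ f ((1 / 2 : ℝ) • s + (1 / 2 : ℝ) • t) := by
      apply hanti _ ⟨by linarith, ht⟩ _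
      · simp only [smul_eq_mul, Set.mem_Ioc]
        constructor <;> linarith
      · simp only [smul_eq_mul]
        linarith
    simp only [smul_eq_mul] at h1 h2
    linarith
  intro s hs t ht hst
  rcases hs.1.eq_or_lt with h0 | h0
  · have ht0 : 0 < t := h0 ▸ hst
    have h1 := key (t / 2) t (by linarith) ht.2 (by linarith)
    have h2 := le_apply_zero_of_antitoneOn hanti hlim (t := t / 2)
      ⟨by linarith, by linarith [ht.2]⟩
    rw [← h0]
    linarith
  · exact key s t h0 ht.2 hst

theorem continuousOn_Icc_of_tendsto (hanti : AntitoneOn f (Set.Ioc 0 4))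
    (hconv : ConvexOn ℝ (Set.Ioc 0 4) f) (hdiff : DifferentiableOn ℝ f (Set.Ioo 0 4))
    (hlim : Filter.Tendsto f (nhdsWithin 0 (Set.Ioi 0)) (nhds (f 0))) :
    ContinuousOn f (Set.Icc 0 4) := by
  intro t ht
  rcases ht.1.eq_or_lt with h0 | h0
  · subst h0
    have h : ContinuousWithinAt f (Set.Ioi 0) 0 := hlim
    exact (continuousWithinAt_Ioi_iff_Ici.1 h).mono Set.Icc_subset_Ici_self
  rcases ht.2.eq_or_lt with h4 | h4
  · subst h4
    have h : Filter.Tendsto f (nhdsWithin 4 (Set.Icc 0 4)) (nhds (f 4)) := by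
      -- Near `4`, `f` is squeezed between `f 4` and its chord over `[2, 4]`.
      have hc : Filter.Tendsto (fun s : ℝ => (4 - s) / 2 * f 2 + (s - 2) / 2 * f 4)
          (nhdsWithin 4 (Set.Icc 0 4)) (nhds (f 4)) := by
        have : ContinuousAt (fun s : ℝ => (4 - s) / 2 * f 2 + (s - 2) / 2 * f 4) 4 := by
          fun_prop
        have h' := this.tendsto
        norm_num at h'
        exact h'.mono_left nhdsWithin_le_nhds
      have hev : ∀ᶠ s : ℝ in nhdsWithin 4 (Set.Icc 0 4), s ∈ Set.Icc (2 : ℝ) 4 := by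
        have h1 : ∀ᶠ s : ℝ in nhdsWithin 4 (Set.Icc 0 4), s ∈ Set.Icc (0 : ℝ) 4 :=
          eventually_mem_nhdsWithin
        have h2 : ∀ᶠ s : ℝ in nhdsWithin 4 (Set.Icc 0 4), (2 : ℝ) < s :=
          nhdsWithin_le_nhds (lt_mem_nhds (by norm_num))
        filter_upwards [h1, h2] with s a b
        exact ⟨b.le, a.2⟩
      refine tendsto_of_tendsto_of_tendsto_of_le_of_le' tendsto_const_nhds hc ?_ ?_
      · filter_upwards [hev] with s hs
        exact hanti ⟨by linarith [hs.1], hs.2⟩ ⟨by norm_num, le_rfl⟩ hs.2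
      · filter_upwards [hev] with s hs
        have h1 := hconv.2 (show (2 : ℝ) ∈ Set.Ioc (0 : ℝ) 4 by norm_num)
          (show (4 : ℝ) ∈ Set.Ioc (0 : ℝ) 4 by norm_num)
          (show 0 ≤ (4 - s) / 2 by linarith [hs.2]) (show 0 ≤ (s - 2) / 2 by linarith [hs.1])
          (by ring)
        simp only [smul_eq_mul] at h1
        convert h1 using 2
        ring
    exact h
  · exact ((hdiff t ⟨h0, h4⟩).differentiableAt (Ioo_mem_nhds h0 h4)).continuousAt.continuousWithinAt

theorem apply_mul_le_of_convexOn_Ioc (hconv : ConvexOn ℝ (Set.Ioc 0 4) f)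
    (hcont : ContinuousOn f (Set.Icc 0 4)) {a b y : ℝ} (ha : 0 ≤ a) (hb : 0 ≤ b)
    (hab : a + b = 1) (hy : y ∈ Set.Ioc (0 : ℝ) 4) :
    f (b * y) ≤ a * f 0 + b * f y := by
  have h1 : Filter.Tendsto (fun s => a * f s + b * f y) (nhdsWithin 0 (Set.Ioc 0 4))
      (nhds (a * f 0 + b * f y)) :=
    (((hcont 0 ⟨le_rfl, by norm_num⟩).mono Set.Ioc_subset_Icc_self).const_mul a).add_const _
  have hmap : Set.MapsTo (fun s => a * s + b * y) (Set.Ioc 0 4) (Set.Icc 0 4) := by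
    intro s hs
    have := convex_Icc (0 : ℝ) 4 (Set.Ioc_subset_Icc_self hs) (Set.Ioc_subset_Icc_self hy) ha hb hab
    simpa using this
  have h2 : Filter.Tendsto (fun s => f (a * s + b * y)) (nhdsWithin 0 (Set.Ioc 0 4))
      (nhds (f (b * y))) := by
    have hc : ContinuousWithinAt f (Set.Icc 0 4) (a * 0 + b * y) := by
      apply hcont
      have := convex_Icc (0 : ℝ) 4 (Set.left_mem_Icc.2 (by norm_num))
        (Set.Ioc_subset_Icc_self hy) ha hb hab
      simpa using this
    have hg : ContinuousWithinAt (fun s => a * s + b * y) (Set.Ioc 0 4) 0 := by fun_prop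
    have := ContinuousWithinAt.comp (x := (0 : ℝ)) (f := fun s => a * s + b * y) hc hg hmap
    simpa [ContinuousWithinAt, Function.comp_def] using this
  have : (nhdsWithin (0 : ℝ) (Set.Ioc 0 4)).NeBot := by
    rw [nhdsWithin_Ioc_eq_nhdsGT (by norm_num)]
    infer_instance
  refine le_of_tendsto_of_tendsto h2 h1 ?_
  filter_upwards [self_mem_nhdsWithin] with s hs
  simpa using hconv.2 hs hy ha hb hab

/-- A limit at `0` loses strictness. Hence the weak inequality is used only at `b / 2 * y`, and
strict convexity is applied between the two positive points `b / 2 * y` and `y`. -/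
theorem apply_mul_lt_of_strictConvexOn_Ioc (hstrict : StrictConvexOn ℝ (Set.Ioc 0 4) f)
    (hcont : ContinuousOn f (Set.Icc 0 4)) {a b y : ℝ} (ha : 0 < a) (hb : 0 < b)
    (hab : a + b = 1) (hy : y ∈ Set.Ioc (0 : ℝ) 4) :
    f (b * y) < a * f 0 + b * f y := by
  have hb1 : b < 1 := by linarith
  have hby : 0 < b * y := mul_pos hb hy.1
  have hb2 : 0 < 1 - b / 2 := by linarith
  have hb3 : 2 - b ≠ 0 := by linarith
  have hp := apply_mul_le_of_convexOn_Ioc hstrict.convexOn hcont (a := 1 - b / 2) (b := b / 2)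
    (y := y) hb2.le (by linarith) (by ring) hy
  have hlt : b / 2 * y < y := by nlinarith [hy.1]
  have hc0 : 0 < (1 - b) / (1 - b / 2) := div_pos (by linarith) hb2
  have hc1 : 0 < b / 2 / (1 - b / 2) := div_pos (by linarith) hb2
  have hs := hstrict.2 (show b / 2 * y ∈ Set.Ioc (0 : ℝ) 4 from ⟨by linarith, by linarith [hy.2]⟩) hy hlt.ne
    hc0 hc1 (by field_simp; ring)
  simp only [smul_eq_mul] at hs
  have e1 : (1 - b) / (1 - b / 2) * (b / 2 * y) + b / 2 / (1 - b / 2) * y = b * y := by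
    field_simp
    ring
  rw [e1] at hs
  have h3 := mul_le_mul_of_nonneg_left hp hc0.le
  have e2 : (1 - b) / (1 - b / 2) * ((1 - b / 2) * f 0 + b / 2 * f y)
      + b / 2 / (1 - b / 2) * f y = a * f 0 + b * f y := by
    rw [← eq_sub_iff_add_eq] at hab
    subst hab
    field_simp
    ring
  linarith

end EndpointExtension

/-! ### Quadratic Hermite interpolation from below. -/

section Interpolation

theorem ConvexOn.nonneg_left_of_zeros {S : Set ℝ} {ψ : ℝ → ℝ} (h : ConvexOn ℝ S ψ)
    {a b s : ℝ} (hb : b ∈ S) (hs : s ∈ S) (hψa : ψ a = 0) (hψb : ψ b = 0)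
    (hsa : s < a) (hab : a < b) : 0 ≤ ψ s := by
  have := h.slope_mono_adjacent hs hb hsa hab
  rw [hψa, hψb, sub_self, zero_div, div_le_iff₀ (by linarith)] at this
  linarith

theorem ConvexOn.nonneg_right_of_zeros {S : Set ℝ} {ψ : ℝ → ℝ} (h : ConvexOn ℝ S ψ)
    {a b s : ℝ} (ha : a ∈ S) (hs : s ∈ S) (hψa : ψ a = 0) (hψb : ψ b = 0)
    (hab : a < b) (hbs : b < s) : 0 ≤ ψ s := by
  have := h.slope_mono_adjacent ha hs hab hbs
  rw [hψa, hψb, sub_self, zero_div, le_div_iff₀ (by linarith)] at this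
  linarith

theorem ConvexOn.nonpos_between_zeros {S : Set ℝ} {ψ : ℝ → ℝ} (h : ConvexOn ℝ S ψ)
    {a b s : ℝ} (ha : a ∈ S) (hb : b ∈ S) (hψa : ψ a = 0) (hψb : ψ b = 0)
    (has : a < s) (hsb : s < b) : ψ s ≤ 0 := by
  have := h.slope_mono_adjacent ha hb has hsb
  rw [hψa, hψb, div_le_div_iff₀ (by linarith) (by linarith)] at this
  nlinarith

/-- A function vanishing at `l` and at an interior point `c`, with convex derivative vanishing
at `c`, is nonnegative. -/
theorem nonneg_of_convexOn_deriv {φ : ℝ → ℝ} {l u c : ℝ} (hc : c ∈ Set.Ioo l u)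
    (hcont : ContinuousOn φ (Set.Icc l u)) (hdiff : DifferentiableOn ℝ φ (Set.Ioo l u))
    (hconv : ConvexOn ℝ (Set.Ioo l u) (deriv φ)) (hl : φ l = 0) (hφc : φ c = 0)
    (hdc : deriv φ c = 0) : ∀ t ∈ Set.Icc l u, 0 ≤ φ t := by
  -- Rolle gives a second zero `ξ < c` of the convex derivative, whose signs are then `+, -, +`: `φ`
  -- rises from `0`, falls to `0` at `c`, and rises again.
  obtain ⟨ξ, hξ, hdξ⟩ := exists_deriv_eq_zero hc.1
    (hcont.mono (Set.Icc_subset_Icc_right hc.2.le)) (hl.trans hφc.symm)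
  have hξ' : ξ ∈ Set.Ioo l u := ⟨hξ.1, hξ.2.trans hc.2⟩
  have hmono1 : MonotoneOn φ (Set.Icc l ξ) := by
    apply monotoneOn_of_deriv_nonneg (convex_Icc _ _)
      (hcont.mono (Set.Icc_subset_Icc_right hξ'.2.le))
    · rw [interior_Icc]
      exact hdiff.mono (Set.Ioo_subset_Ioo_right hξ'.2.le)
    · rw [interior_Icc]
      intro s hs
      exact hconv.nonneg_left_of_zeros hc ⟨hs.1, hs.2.trans hξ'.2⟩ hdξ hdc hs.2 hξ.2
  have hanti : AntitoneOn φ (Set.Icc ξ c) := by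
    apply antitoneOn_of_deriv_nonpos (convex_Icc _ _)
      (hcont.mono (Set.Icc_subset_Icc hξ.1.le hc.2.le))
    · rw [interior_Icc]
      exact hdiff.mono (Set.Ioo_subset_Ioo hξ.1.le hc.2.le)
    · rw [interior_Icc]
      intro s hs
      exact hconv.nonpos_between_zeros hξ' hc hdξ hdc hs.1 hs.2
  have hmono2 : MonotoneOn φ (Set.Icc c u) := by
    apply monotoneOn_of_deriv_nonneg (convex_Icc _ _)
      (hcont.mono (Set.Icc_subset_Icc_left hc.1.le))
    · rw [interior_Icc]
      exact hdiff.mono (Set.Ioo_subset_Ioo_left hc.1.le)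
    · rw [interior_Icc]
      intro s hs
      exact hconv.nonneg_right_of_zeros hξ' ⟨hc.1.trans hs.1, hs.2⟩ hdξ hdc hξ.2 hs.1
  intro t ht
  rcases le_total t ξ with h | h
  · rw [← hl]
    exact hmono1 ⟨le_rfl, hξ.1.le⟩ ⟨ht.1, h⟩ ht.1
  rcases le_total t c with h' | h'
  · rw [← hφc]
    exact hanti ⟨h, h'⟩ ⟨hξ.2.le, le_rfl⟩ h'
  · rw [← hφc]
    exact hmono2 ⟨le_rfl, hc.2.le⟩ ⟨h', ht.2⟩ h'

theorem exists_quadratic_le {f : ℝ → ℝ} {u c : ℝ} (hc : c ∈ Set.Ioo 0 u)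
    (hcont : ContinuousOn f (Set.Icc 0 u)) (hdiff : DifferentiableOn ℝ f (Set.Ioo 0 u))
    (hderiv : ConvexOn ℝ (Set.Ioo 0 u) (deriv f)) :
    ∃ A B C : ℝ, (∀ t ∈ Set.Icc 0 u, A + B * t + C * t ^ 2 ≤ f t) ∧
      f 0 = A ∧ f c = A + B * c + C * c ^ 2 := by
  have hc0 : c ≠ 0 := hc.1.ne'
  -- `B` and `C` solve the conditions that `f 0 + B t + C t²` match both `f` and `f'` at `c`.
  obtain ⟨C, hC⟩ : ∃ C, C = (deriv f c * c - f c + f 0) / c ^ 2 := ⟨_, rfl⟩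
  obtain ⟨B, hB⟩ : ∃ B, B = deriv f c - 2 * C * c := ⟨_, rfl⟩
  have hval : f c = f 0 + B * c + C * c ^ 2 := by
    rw [hB, hC]
    field_simp
    ring
  refine ⟨f 0, B, C, ?_, rfl, hval⟩
  have hd : ∀ t ∈ Set.Ioo 0 u, HasDerivAt (fun s => f s - (f 0 + B * s + C * s ^ 2))
      (deriv f t - (B + 2 * C * t)) t := by
    intro t ht
    have h1 := ((hdiff t ht).differentiableAt (Ioo_mem_nhds ht.1 ht.2)).hasDerivAt
    have h2 : HasDerivAt (fun s : ℝ => f 0 + B * s + C * s ^ 2) (B + 2 * C * t) t := by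
      refine ((((hasDerivAt_id' t).const_mul B).const_add (f 0)).add
        ((hasDerivAt_pow 2 t).const_mul C)).congr_deriv ?_
      norm_num
      ring
    exact h1.sub h2
  have hq : ConcaveOn ℝ (Set.Ioo 0 u) (fun t => B + 2 * C * t) := by
    refine ⟨convex_Ioo _ _, fun x _ y _ a b _ _ hab => le_of_eq ?_⟩
    simp only [smul_eq_mul]
    linear_combination B * hab
  have := nonneg_of_convexOn_deriv (φ := fun s => f s - (f 0 + B * s + C * s ^ 2)) hc
    (hcont.sub (by fun_prop)) (fun t ht => (hd t ht).differentiableAt.differentiableWithinAt)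
    ?_ (by simp) (by linarith) (by rw [(hd c hc).deriv, hB]; ring)
  · intro t ht
    linarith [this t ht]
  · exact (hderiv.sub hq).congr fun t ht => ((hd t ht).deriv).symm

end Interpolation

/-! ### Half-spaces, facet normals and barycentric coordinates of the origin. -/

section Duality

variable {ι E : Type*} [Fintype ι] [NormedAddCommGroup E] [InnerProductSpace ℝ E]
  [FiniteDimensional ℝ E]

theorem exists_nontrivial_sum_smul_eq_zero (v : ι → E)
    (hcard : Module.finrank ℝ E < Fintype.card ι) :
    ∃ a : ι → ℝ, ∑ i, a i • v i = 0 ∧ ∃ i, a i ≠ 0 := by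
  apply Fintype.not_linearIndependent_iff.1
  intro h
  exact absurd h.fintype_card_le_finrank (not_le.2 hcard)

/-- Given `dim E + 1` vectors in `E`, either some closed half-space through the origin contains
all of them, or there are normals `x j` to the facets of the simplex they span; the latter
are described by the heights `T j` of the opposite vertices. -/
theorem exists_inner_nonpos_or_exists_facet_normals [DecidableEq ι] [Nontrivial E]
    (v : ι → E) (hcard : Fintype.card ι = Module.finrank ℝ E + 1) :
    (∃ x : E, x ≠ 0 ∧ ∀ i, ⟪x, v i⟫_ℝ ≤ 0) ∨
      ∃ (x : ι → E) (T : ι → ℝ), (∀ j, 0 < T j) ∧ (∀ j i, i ≠ j → ⟪x j, v i⟫_ℝ = -1) ∧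
        (∀ j, ⟪x j, v j⟫_ℝ = T j) ∧ ∑ j, 1 / (1 + T j) = 1 := by
  by_cases hA : ∃ x : E, x ≠ 0 ∧ ∀ i, ⟪x, v i⟫_ℝ ≤ 0
  · exact Or.inl hA
  right
  push Not at hA
  have hx : ∀ j, ∃ x : E, ∀ i, i ≠ j → ⟪x, v i⟫_ℝ = -1 := by
    intro j
    let L : E →ₗ[ℝ] ({i // i ≠ j} → ℝ) := LinearMap.pi fun i => (innerₗ E).flip (v i)
    -- If `L x = 0` with `x ≠ 0`, then `x` and `-x` both have a positive product with some `v i`,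
    -- necessarily `v j`: a contradiction. Equal dimensions then make `L` surjective.
    have hL : ∀ x i, L x i = ⟪x, v i⟫_ℝ := fun x i => rfl
    have hinj : Function.Injective L := by
      rw [injective_iff_map_eq_zero]
      intro x h0
      by_contra hne
      have hz : ∀ i, i ≠ j → ⟪x, v i⟫_ℝ = 0 := fun i hi => by
        rw [← hL x ⟨i, hi⟩, h0]
        rfl
      obtain ⟨i, hi⟩ := hA x hne
      obtain ⟨k, hk⟩ := hA (-x) (neg_ne_zero.2 hne)
      have hij : i = j := by
        by_contra h
        rw [hz i h] at hi
        exact lt_irrefl _ hi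
      have hkj : k = j := by
        by_contra h
        rw [inner_neg_left, hz k h] at hk
        simp at hk
      rw [inner_neg_left, hkj] at hk
      rw [hij] at hi
      linarith
    have hfin : Module.finrank ℝ E = Module.finrank ℝ ({i // i ≠ j} → ℝ) := by
      rw [Module.finrank_fintype_fun_eq_card, Fintype.card_subtype_compl, Fintype.card_subtype_eq,
        hcard, Nat.add_sub_cancel]
    obtain ⟨x, hx⟩ :=
      (LinearMap.injective_iff_surjective_of_finrank_eq_finrank hfin).1 hinj (fun _ => -1)
    exact ⟨x, fun i hi => by rw [← hL x ⟨i, hi⟩, hx]⟩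
  choose x hx using hx
  obtain ⟨a, ha, k, hk⟩ := exists_nontrivial_sum_smul_eq_zero v (by omega)
  -- Pairing the dependency `∑ a i • v i = 0` with `x j` shows that `1 / (1 + T j)` is the
  -- normalised coefficient `a j / ∑ a i`.
  have hrel : ∀ j, a j * (1 + ⟪x j, v j⟫_ℝ) = ∑ i, a i := by
    intro j
    have h1 : ∑ i, a i * ⟪x j, v i⟫_ℝ = 0 := by
      have := congrArg (fun z => ⟪x j, z⟫_ℝ) ha
      simpa [inner_sum, inner_smul_right] using this
    rw [← Finset.add_sum_erase _ _ (Finset.mem_univ j)] at h1 ⊢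
    rw [Finset.sum_congr rfl fun i hi => by rw [hx j i (Finset.ne_of_mem_erase hi)]] at h1
    rw [← Finset.sum_mul] at h1
    linarith
  have hT : ∀ j, 0 < ⟪x j, v j⟫_ℝ := by
    intro j
    have hne : x j ≠ 0 := by
      have hpos : 0 < Module.finrank ℝ E := Module.finrank_pos
      have : Nontrivial ι := Fintype.one_lt_card_iff_nontrivial.1 (by omega)
      obtain ⟨i, hi⟩ := exists_ne j
      intro h0
      have := hx j i hi
      rw [h0, inner_zero_left] at this
      norm_num at this
    obtain ⟨i, hi⟩ := hA (x j) hne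
    by_cases hij : i = j
    · rwa [hij] at hi
    · rw [hx j i hij] at hi
      norm_num at hi
  have hS : ∑ i, a i ≠ 0 := by
    rw [← hrel k]
    exact mul_ne_zero hk (by linarith [hT k])
  refine ⟨x, fun j => ⟪x j, v j⟫_ℝ, hT, hx, fun _ => rfl, ?_⟩
  have : ∀ j, 1 / (1 + ⟪x j, v j⟫_ℝ) = a j / ∑ i, a i := by
    intro j
    have := hT j
    rw [div_eq_div_iff (by linarith) hS, one_mul, hrel j]
  simp_rw [this, ← Finset.sum_div]
  exact div_self hS

end Duality

/-! ### One-variable inequalities for the potential at a facet normal. -/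

section FacetEstimate

variable {f : ℝ → ℝ} {D : ℝ}

theorem two_add_two_div_mem_Ioo (hD : 1 < D) : 2 + 2 / D ∈ Set.Ioo (0 : ℝ) 4 := by
  have h0 : 0 < 2 / D := by positivity
  have h1 : 2 / D < 2 := by rw [div_lt_iff₀ (by linarith)]; linarith
  constructor <;> linarith

/-- `2` is the mean of `0` and `2 + 2 / D` with weights `1 / (D + 1)` and `D / (D + 1)`. -/
theorem center_value_le (hD : 1 < D) (hconv : ConvexOn ℝ (Set.Ioc 0 4) f)
    (hcont : ContinuousOn f (Set.Icc 0 4)) :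
    (D + 1) * f 2 ≤ f 0 + D * f (2 + 2 / D) := by
  have h := apply_mul_le_of_convexOn_Ioc hconv hcont (a := 1 / (D + 1)) (b := D / (D + 1))
    (by positivity) (by positivity) (by field_simp; ring)
    (Set.Ioo_subset_Ioc_self (two_add_two_div_mem_Ioo hD))
  rw [show D / (D + 1) * (2 + 2 / D) = 2 by field_simp, div_mul_eq_mul_div, div_mul_eq_mul_div,
    ← add_div, le_div_iff₀ (by linarith)] at h
  linarith

theorem center_value_lt (hD : 1 < D) (hstrict : StrictConvexOn ℝ (Set.Ioc 0 4) f)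
    (hcont : ContinuousOn f (Set.Icc 0 4)) :
    (D + 1) * f 2 < f 0 + D * f (2 + 2 / D) := by
  have h := apply_mul_lt_of_strictConvexOn_Ioc hstrict hcont (a := 1 / (D + 1)) (b := D / (D + 1))
    (by positivity) (by positivity) (by field_simp; ring)
    (Set.Ioo_subset_Ioc_self (two_add_two_div_mem_Ioo hD))
  rw [show D / (D + 1) * (2 + 2 / D) = 2 by field_simp, div_mul_eq_mul_div, div_mul_eq_mul_div,
    ← add_div, lt_div_iff₀ (by linarith)] at h
  linarith

/-- One weight `r * D` serves both terms: `2 - 2rD` lies between `0` and `2`, and `2 + 2r` between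
`2 + 2/D` and `2`, in the same proportion. The bound thus interpolates between the simplex value and
the value `(D + 1) f 2`. -/
theorem facet_value_le_combination (hD : 1 < D) (hanti : AntitoneOn f (Set.Icc 0 4))
    (hconv : ConvexOn ℝ (Set.Ioc 0 4) f) (hcont : ContinuousOn f (Set.Icc 0 4))
    {r t : ℝ} (hr0 : 0 ≤ r) (hrD : r * D ≤ 1) (ht0 : 0 ≤ t) (ht : t ≤ r * D) :
    f (2 - 2 * t) + D * f (2 + 2 * r) ≤
      r * D * (f 0 + D * f (2 + 2 / D)) + (1 - r * D) * ((D + 1) * f 2) := by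
  have hl0 : 0 ≤ r * D := by positivity
  have h1 : f (2 - 2 * t) ≤ f (2 - 2 * (r * D)) :=
    hanti ⟨by linarith, by linarith⟩ ⟨by linarith, by linarith⟩ (by linarith)
  have h2 := apply_mul_le_of_convexOn_Ioc hconv hcont hl0 (b := 1 - r * D) (by linarith)
    (by ring) (show (2 : ℝ) ∈ Set.Ioc (0 : ℝ) 4 by norm_num)
  rw [show (1 - r * D) * 2 = 2 - 2 * (r * D) by ring] at h2
  have h3 := hconv.2 (Set.Ioo_subset_Ioc_self (two_add_two_div_mem_Ioo hD))
    (show (2 : ℝ) ∈ Set.Ioc (0 : ℝ) 4 by norm_num) hl0 (sub_nonneg.2 hrD) (by ring)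
  simp only [smul_eq_mul] at h3
  rw [show r * D * (2 + 2 / D) + (1 - r * D) * 2 = 2 + 2 * r by field_simp; ring] at h3
  have h4 := mul_le_mul_of_nonneg_left h3 (show 0 ≤ D by linarith)
  linarith

/-- Here `r` is the distance from the origin to the facet and `t` the height of the opposite vertex
along the unit normal. Convexity handles `r * D ≤ 1`; beyond that, monotonicity bounds each term
separately. -/
theorem facet_value_le (hD : 1 < D) (hanti : AntitoneOn f (Set.Icc 0 4))
    (hconv : ConvexOn ℝ (Set.Ioc 0 4) f) (hcont : ContinuousOn f (Set.Icc 0 4))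
    {r t : ℝ} (hr0 : 0 ≤ r) (hr1 : r ≤ 1) (ht0 : 0 ≤ t) (ht1 : t ≤ 1) (ht : t ≤ r * D) :
    f (2 - 2 * t) + D * f (2 + 2 * r) ≤ f 0 + D * f (2 + 2 / D) := by
  rcases le_total (r * D) 1 with h | h
  · have h1 := facet_value_le_combination hD hanti hconv hcont hr0 h ht0 ht
    have h2 := mul_le_mul_of_nonneg_left (center_value_le hD hconv hcont) (sub_nonneg.2 h)
    linarith
  · have hI := two_add_two_div_mem_Ioo hD
    have h1 : f (2 - 2 * t) ≤ f 0 :=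
      hanti ⟨le_rfl, by norm_num⟩ ⟨by linarith, by linarith⟩ (by linarith)
    have hle : 1 / D ≤ r := by rwa [div_le_iff₀ (by linarith)]
    have h2 : f (2 + 2 * r) ≤ f (2 + 2 / D) :=
      hanti (Set.Ioo_subset_Icc_self hI) ⟨by linarith, by linarith⟩
        (by rw [div_eq_mul_one_div]; linarith)
    have h3 := mul_le_mul_of_nonneg_left h2 (show 0 ≤ D by linarith)
    linarith

theorem eq_of_facet_value_eq (hD : 1 < D) (hanti : StrictAntiOn f (Set.Icc 0 4))
    (hstrict : StrictConvexOn ℝ (Set.Ioc 0 4) f) (hcont : ContinuousOn f (Set.Icc 0 4))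
    {r t : ℝ} (hr0 : 0 ≤ r) (hr1 : r ≤ 1) (ht0 : 0 ≤ t) (ht1 : t ≤ 1) (ht : t ≤ r * D)
    (heq : f 0 + D * f (2 + 2 / D) ≤ f (2 - 2 * t) + D * f (2 + 2 * r)) :
    r * D = 1 ∧ t = 1 := by
  have hI := two_add_two_div_mem_Ioo hD
  have h1 : f (2 - 2 * t) ≤ f 0 :=
    hanti.antitoneOn ⟨le_rfl, by norm_num⟩ ⟨by linarith, by linarith⟩ (by linarith)
  rcases lt_trichotomy (r * D) 1 with h | h | h
  · have h1 := facet_value_le_combination hD hanti.antitoneOn hstrict.convexOn hcont hr0 h.le ht0 ht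
    have h2 := mul_lt_mul_of_pos_left (center_value_lt hD hstrict hcont) (sub_pos.2 h)
    linarith
  · refine ⟨h, ?_⟩
    have hr : 2 + 2 / D = 2 + 2 * r := by
      field_simp
      linarith
    rw [hr] at heq
    by_contra hne
    have hlt : t < 1 := lt_of_le_of_ne ht1 hne
    have : f (2 - 2 * t) < f 0 :=
      hanti ⟨le_rfl, by norm_num⟩ ⟨by linarith, by linarith⟩ (by linarith)
    linarith
  · have hle : 1 / D < r := by rwa [div_lt_iff₀ (by linarith)]
    have h2 : f (2 + 2 * r) < f (2 + 2 / D) :=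
      hanti (Set.Ioo_subset_Icc_self hI) ⟨by linarith, by linarith⟩
        (by rw [div_eq_mul_one_div]; linarith)
    have h3 := mul_lt_mul_of_pos_left h2 (show 0 < D by linarith)
    linarith

end FacetEstimate

/-! ### Upper bound for arbitrary configurations, and its equality case. -/

section UpperBound

variable {ι E : Type*} [Fintype ι] [NormedAddCommGroup E] [InnerProductSpace ℝ E]

theorem norm_sub_sq_of_norm_eq_one {x y : E} (hx : ‖x‖ = 1) (hy : ‖y‖ = 1) :
    ‖x - y‖ ^ 2 = 2 - 2 * ⟪x, y⟫_ℝ := by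
  rw [norm_sub_sq_real, hx, hy]
  ring

theorem abs_inner_le_one_of_norm_eq_one {x y : E} (hx : ‖x‖ = 1) (hy : ‖y‖ = 1) :
    |⟪x, y⟫_ℝ| ≤ 1 := by
  simpa [hx, hy] using abs_real_inner_le_norm x y

theorem norm_sub_sq_mem_Icc {x y : E} (hx : ‖x‖ = 1) (hy : ‖y‖ = 1) :
    ‖x - y‖ ^ 2 ∈ Set.Icc (0 : ℝ) 4 := by
  have := abs_le.1 (abs_inner_le_one_of_norm_eq_one hx hy)
  rw [norm_sub_sq_of_norm_eq_one hx hy]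
  constructor <;> linarith [this.1, this.2]

theorem exists_le_of_sum_one_div_eq_one {D : ℝ} (hD : 0 ≤ D) (hcard : (Fintype.card ι : ℝ) = D + 1)
    {T : ι → ℝ} (hsum : ∑ j, 1 / (1 + T j) = 1) : ∃ j, T j ≤ D := by
  by_contra! h
  have hne : Nonempty ι := by
    by_contra hemp
    rw [not_nonempty_iff] at hemp
    simp at hsum
  have : ∑ j, 1 / (1 + T j) < ∑ _j : ι, 1 / (1 + D) :=
    Finset.sum_lt_sum_of_nonempty Finset.univ_nonempty fun j _ =>
      one_div_lt_one_div_of_lt (by linarith) (by linarith [h j])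
  rw [hsum, Finset.sum_const, Finset.card_univ, nsmul_eq_mul, hcard, add_comm D 1,
    mul_one_div_cancel (by linarith)] at this
  exact lt_irrefl _ this

theorem eq_of_sum_one_div_eq_one {D : ℝ} (hD : 0 ≤ D) (hcard : (Fintype.card ι : ℝ) = D + 1)
    {T : ι → ℝ} (hge : ∀ j, D ≤ T j) (hsum : ∑ j, 1 / (1 + T j) = 1) (j : ι) : T j = D := by
  have hle : ∀ i ∈ Finset.univ, 1 / (1 + T i) ≤ 1 / (1 + D) := fun i _ =>
    one_div_le_one_div_of_le (by linarith) (by linarith [hge i])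
  have hs : ∑ i, 1 / (1 + T i) = ∑ _i : ι, 1 / (1 + D) := by
    rw [hsum, Finset.sum_const, Finset.card_univ, nsmul_eq_mul, hcard, add_comm D 1,
      mul_one_div_cancel (by linarith)]
  have := (Finset.sum_eq_sum_iff_of_le hle).1 hs j (Finset.mem_univ j)
  rw [div_eq_div_iff (by linarith [hge j]) (by linarith)] at this
  linarith

variable {f : ℝ → ℝ} {D : ℝ} {v : ι → E}

/-- The value of the potential at the unit normal to a facet. -/
theorem sum_apply_norm_sub_sq_facet [DecidableEq ι] (hcard : (Fintype.card ι : ℝ) = D + 1)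
    (hv : ∀ i, ‖v i‖ = 1) {x : E} {j : ι} {T : ℝ} (hx0 : x ≠ 0)
    (hx : ∀ i, i ≠ j → ⟪x, v i⟫_ℝ = -1) (hxj : ⟪x, v j⟫_ℝ = T) :
    ∑ i, f (‖‖x‖⁻¹ • x - v i‖ ^ 2) = f (2 - 2 * (‖x‖⁻¹ * T)) + D * f (2 + 2 * ‖x‖⁻¹) := by
  have hn : ‖‖x‖⁻¹ • x‖ = 1 := norm_smul_inv_norm hx0
  rw [← Finset.add_sum_erase _ _ (Finset.mem_univ j), norm_sub_sq_of_norm_eq_one hn (hv j),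
    real_inner_smul_left, hxj]
  congr 1
  rw [Finset.sum_congr rfl fun i hi => by
    rw [norm_sub_sq_of_norm_eq_one hn (hv i), real_inner_smul_left, hx i (Finset.ne_of_mem_erase hi)]]
  rw [Finset.sum_const, Finset.card_erase_of_mem (Finset.mem_univ j), Finset.card_univ,
    nsmul_eq_mul, Nat.cast_sub (Fintype.card_pos_iff.2 ⟨j⟩), hcard]
  norm_num

theorem one_le_norm_and_le_norm_of_facet_normal {κ : Type*} [Nontrivial κ] {w : κ → E}
    (hw : ∀ i, ‖w i‖ = 1) {x : E} {j : κ} {T : ℝ} (hx : ∀ i, i ≠ j → ⟪x, w i⟫_ℝ = -1)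
    (hxj : ⟪x, w j⟫_ℝ = T) : 1 ≤ ‖x‖ ∧ T ≤ ‖x‖ := by
  obtain ⟨i, hi⟩ := exists_ne j
  have h1 := abs_real_inner_le_norm x (w i)
  have h2 := real_inner_le_norm x (w j)
  rw [hw, mul_one] at h1 h2
  rw [hx i hi] at h1
  rw [hxj] at h2
  norm_num at h1
  exact ⟨h1, h2⟩

theorem exists_sum_apply_norm_sub_sq_le_center (hcard : (Fintype.card ι : ℝ) = D + 1)
    (hv : ∀ i, ‖v i‖ = 1) (hanti : AntitoneOn f (Set.Icc 0 4)) {x : E} (hx0 : x ≠ 0)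
    (hx : ∀ i, ⟪x, v i⟫_ℝ ≤ 0) :
    ∃ x : E, ‖x‖ = 1 ∧ ∑ i, f (‖x - v i‖ ^ 2) ≤ (D + 1) * f 2 := by
  have hn : ‖‖x‖⁻¹ • x‖ = 1 := norm_smul_inv_norm hx0
  refine ⟨‖x‖⁻¹ • x, hn, ?_⟩
  have : ∀ i ∈ Finset.univ, f (‖‖x‖⁻¹ • x - v i‖ ^ 2) ≤ f 2 := by
    intro i _
    refine hanti ⟨by norm_num, by norm_num⟩ (norm_sub_sq_mem_Icc hn (hv i)) ?_
    rw [norm_sub_sq_of_norm_eq_one hn (hv i), real_inner_smul_left]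
    have := mul_nonneg (inv_nonneg.2 (norm_nonneg x)) (neg_nonneg.2 (hx i))
    linarith
  have h := Finset.sum_le_sum this
  rwa [Finset.sum_const, Finset.card_univ, nsmul_eq_mul, hcard] at h

variable [FiniteDimensional ℝ E]

theorem exists_sum_apply_norm_sub_sq_le (hD : 1 < D) (hfin : (Module.finrank ℝ E : ℝ) = D)
    (hcard : Fintype.card ι = Module.finrank ℝ E + 1) (hv : ∀ i, ‖v i‖ = 1)
    (hanti : AntitoneOn f (Set.Icc 0 4)) (hconv : ConvexOn ℝ (Set.Ioc 0 4) f)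
    (hcont : ContinuousOn f (Set.Icc 0 4)) :
    ∃ x : E, ‖x‖ = 1 ∧ ∑ i, f (‖x - v i‖ ^ 2) ≤ f 0 + D * f (2 + 2 / D) := by
  classical
  have hcard' : (Fintype.card ι : ℝ) = D + 1 := by rw [hcard, ← hfin]; push_cast; rfl
  have hpos : 0 < Module.finrank ℝ E := by
    have : (0 : ℝ) < Module.finrank ℝ E := by linarith
    exact_mod_cast this
  have : Nontrivial E := Module.finrank_pos_iff.1 hpos
  have : Nontrivial ι := Fintype.one_lt_card_iff_nontrivial.1 (by omega)
  rcases exists_inner_nonpos_or_exists_facet_normals v hcard with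
    ⟨x, hx0, hx⟩ | ⟨x, T, hT, hx, hxj, hsum⟩
  · obtain ⟨y, hy, hle⟩ := exists_sum_apply_norm_sub_sq_le_center hcard' hv hanti hx0 hx
    exact ⟨y, hy, hle.trans (center_value_le hD hconv hcont)⟩
  -- The chosen facet has `T j ≤ D`, which is the condition `t ≤ r * D` for `r = ‖x j‖⁻¹`, `t = ‖x
  -- j‖⁻¹ * T j`.
  · obtain ⟨j, hj⟩ := exists_le_of_sum_one_div_eq_one (by linarith) hcard' hsum
    obtain ⟨h1, h2⟩ := one_le_norm_and_le_norm_of_facet_normal hv (hx j) (hxj j)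
    have hpos : 0 < ‖x j‖ := by linarith
    have hx0 : x j ≠ 0 := norm_pos_iff.1 hpos
    refine ⟨‖x j‖⁻¹ • x j, norm_smul_inv_norm hx0, ?_⟩
    rw [sum_apply_norm_sub_sq_facet hcard' hv hx0 (hx j) (hxj j)]
    have hinv := inv_pos.2 hpos
    exact facet_value_le hD hanti hconv hcont hinv.le (inv_le_one_of_one_le₀ h1)
      (mul_pos hinv (hT j)).le (inv_mul_le_one_of_le₀ h2 hpos.le)
      (mul_le_mul_of_nonneg_left hj hinv.le)

theorem inner_eq_of_forall_le_sum_apply_norm_sub_sq (hD : 1 < D)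
    (hfin : (Module.finrank ℝ E : ℝ) = D)
    (hcard : Fintype.card ι = Module.finrank ℝ E + 1) (hv : ∀ i, ‖v i‖ = 1)
    (hanti : StrictAntiOn f (Set.Icc 0 4)) (hstrict : StrictConvexOn ℝ (Set.Ioc 0 4) f)
    (hcont : ContinuousOn f (Set.Icc 0 4))
    (hmin : ∀ x : E, ‖x‖ = 1 → f 0 + D * f (2 + 2 / D) ≤ ∑ i, f (‖x - v i‖ ^ 2))
    {i j : ι} (hij : i ≠ j) : ⟪v i, v j⟫_ℝ = -1 / D := by
  classical
  have hcard' : (Fintype.card ι : ℝ) = D + 1 := by rw [hcard, ← hfin]; push_cast; rfl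
  have hpos : 0 < Module.finrank ℝ E := by
    have : (0 : ℝ) < Module.finrank ℝ E := by linarith
    exact_mod_cast this
  have : Nontrivial E := Module.finrank_pos_iff.1 hpos
  have : Nontrivial ι := ⟨i, j, hij⟩
  rcases exists_inner_nonpos_or_exists_facet_normals v hcard with
    ⟨x, hx0, hx⟩ | ⟨x, T, hT, hx, hxj, hsum⟩
  · obtain ⟨y, hy, hle⟩ := exists_sum_apply_norm_sub_sq_le_center hcard' hv hanti.antitoneOn hx0 hx
    linarith [hmin y hy, center_value_lt hD hstrict hcont]
  have key : ∀ k, T k ≤ D → ‖x k‖ = D ∧ T k = D := by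
    intro k hk
    obtain ⟨h1, h2⟩ := one_le_norm_and_le_norm_of_facet_normal hv (hx k) (hxj k)
    have hpos : 0 < ‖x k‖ := by linarith
    have hx0 : x k ≠ 0 := norm_pos_iff.1 hpos
    have hm := hmin (‖x k‖⁻¹ • x k) (norm_smul_inv_norm hx0)
    rw [sum_apply_norm_sub_sq_facet hcard' hv hx0 (hx k) (hxj k)] at hm
    have hinv := inv_pos.2 hpos
    obtain ⟨e1, e2⟩ := eq_of_facet_value_eq hD hanti hstrict hcont hinv.le
      (inv_le_one_of_one_le₀ h1) (mul_pos hinv (hT k)).le (inv_mul_le_one_of_le₀ h2 hpos.le)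
      (mul_le_mul_of_nonneg_left hk hinv.le) hm
    rw [inv_mul_eq_one₀ hpos.ne'] at e1 e2
    exact ⟨e1, e2 ▸ e1⟩
  -- By `key` no `T k` lies below `D`, so the sum condition leaves no room above `D` either.
  have hTD : ∀ k, T k = D := eq_of_sum_one_div_eq_one (by linarith) hcard'
    (fun k => (le_total D (T k)).elim id fun h => (key k h).2.ge) hsum
  have hnorm := (key i (hTD i).le).1
  -- Equality case of Cauchy–Schwarz: `⟪x i, v i⟫ = D = ‖x i‖ * ‖v i‖`.
  have hxi : x i = D • v i := by
    have := (inner_eq_norm_mul_iff_real (x := x i) (y := v i)).1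
      (by rw [hxj, hTD, hv, hnorm, mul_one])
    rwa [hv, one_smul, hnorm] at this
  have h := hx i j hij.symm
  rw [hxi, real_inner_smul_left] at h
  rw [eq_div_iff (by linarith)]
  linarith

end UpperBound

/-! ### Design properties and symmetries of vectors with the simplex Gram matrix. -/

section SimplexGram

variable {ι E : Type*} [NormedAddCommGroup E] [InnerProductSpace ℝ E] {D : ℝ} {v : ι → E}

/-- The Gram matrix is `(1 + 1/D) I - (1/D) J`, with `J` the all-ones matrix. -/
theorem sum_inner_smul_of_gram (hv : ∀ i, ‖v i‖ = 1)
    (hG : ∀ i j, i ≠ j → ⟪v i, v j⟫_ℝ = -1 / D) (s : Finset ι) (c : ι → ℝ) {j : ι} (hj : j ∈ s) :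
    ⟪∑ i ∈ s, c i • v i, v j⟫_ℝ = (1 + 1 / D) * c j - 1 / D * ∑ i ∈ s, c i := by
  classical
  simp_rw [sum_inner, real_inner_smul_left]
  rw [← Finset.add_sum_erase _ _ hj, ← Finset.add_sum_erase _ c hj,
    real_inner_self_eq_norm_sq, hv,
    Finset.sum_congr rfl fun i hi => by rw [hG i j (Finset.ne_of_mem_erase hi)], ← Finset.sum_mul]
  ring

theorem affineIndependent_of_gram (hD : 0 < D) (hv : ∀ i, ‖v i‖ = 1)
    (hG : ∀ i j, i ≠ j → ⟪v i, v j⟫_ℝ = -1 / D) : AffineIndependent ℝ v := by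
  rw [affineIndependent_iff]
  intro s e he h0 j hj
  have h := sum_inner_smul_of_gram hv hG s e hj
  rw [h0, he, inner_zero_left, mul_zero, sub_zero] at h
  have : (1 + 1 / D) ≠ 0 := by positivity
  exact (mul_eq_zero.1 h.symm).resolve_left this

variable [Fintype ι]

theorem norm_sq_sum_smul_of_gram (hv : ∀ i, ‖v i‖ = 1)
    (hG : ∀ i j, i ≠ j → ⟪v i, v j⟫_ℝ = -1 / D) (c : ι → ℝ) :
    ‖∑ i, c i • v i‖ ^ 2 = (1 + 1 / D) * ∑ i, c i ^ 2 - 1 / D * (∑ i, c i) ^ 2 := by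
  rw [← real_inner_self_eq_norm_sq, inner_sum]
  have h : ∀ j, ⟪∑ i, c i • v i, c j • v j⟫_ℝ =
      (1 + 1 / D) * c j ^ 2 - 1 / D * (∑ i, c i) * c j := by
    intro j
    rw [real_inner_smul_right, sum_inner_smul_of_gram hv hG _ c (Finset.mem_univ j)]
    ring
  rw [Finset.sum_congr rfl fun j _ => h j, Finset.sum_sub_distrib, ← Finset.mul_sum,
    ← Finset.mul_sum]
  ring

theorem sum_eq_zero_of_gram (hD : 0 < D) (hcard : (Fintype.card ι : ℝ) = D + 1)
    (hv : ∀ i, ‖v i‖ = 1) (hG : ∀ i j, i ≠ j → ⟪v i, v j⟫_ℝ = -1 / D) : ∑ i, v i = 0 := by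
  have h := norm_sq_sum_smul_of_gram hv hG fun _ => 1
  simp only [one_smul, one_pow, Finset.sum_const, Finset.card_univ, nsmul_eq_mul, hcard] at h
  rw [← norm_eq_zero, ← sq_eq_zero_iff, h]
  field_simp
  ring

theorem sum_inner_eq_zero_of_gram (hD : 0 < D) (hcard : (Fintype.card ι : ℝ) = D + 1)
    (hv : ∀ i, ‖v i‖ = 1) (hG : ∀ i j, i ≠ j → ⟪v i, v j⟫_ℝ = -1 / D) (x : E) :
    ∑ i, ⟪x, v i⟫_ℝ = 0 := by
  rw [← inner_sum, sum_eq_zero_of_gram hD hcard hv hG, inner_zero_right]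

theorem sum_apply_norm_sub_sq_vertex_of_gram {f : ℝ → ℝ} (hcard : (Fintype.card ι : ℝ) = D + 1)
    (hv : ∀ i, ‖v i‖ = 1) (hG : ∀ i j, i ≠ j → ⟪v i, v j⟫_ℝ = -1 / D) (j : ι) :
    ∑ i, f (‖v j - v i‖ ^ 2) = f 0 + D * f (2 + 2 / D) := by
  classical
  rw [← Finset.add_sum_erase _ _ (Finset.mem_univ j),
    Finset.sum_congr rfl fun i hi => by
      rw [norm_sub_sq_of_norm_eq_one (hv j) (hv i), hG j i (Finset.ne_of_mem_erase hi).symm],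
    Finset.sum_const, Finset.card_erase_of_mem (Finset.mem_univ j), Finset.card_univ,
    nsmul_eq_mul, Nat.cast_sub (Fintype.card_pos_iff.2 ⟨j⟩), hcard, sub_self, norm_zero]
  norm_num
  left
  congr 1
  ring

variable [FiniteDimensional ℝ E]

theorem span_eq_top_of_gram (hD : 0 < D) (hcard : Fintype.card ι = Module.finrank ℝ E + 1)
    (hv : ∀ i, ‖v i‖ = 1) (hG : ∀ i j, i ≠ j → ⟪v i, v j⟫_ℝ = -1 / D) :
    Submodule.span ℝ (Set.range v) = ⊤ := by
  have h := (affineIndependent_of_gram hD hv hG).vectorSpan_eq_top_of_card_eq_finrank_add_one hcard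
  rw [eq_top_iff, ← h, vectorSpan_def, Submodule.span_le]
  rintro _ ⟨x, hx, y, hy, rfl⟩
  exact Submodule.sub_mem _ (Submodule.subset_span hx) (Submodule.subset_span hy)

/-- The tight frame identity. The `v j` span, so it suffices to check it on them, where it follows
from `∑ v i = 0`. -/
theorem sum_inner_smul_eq_of_gram (hD : 0 < D) (hfin : (Module.finrank ℝ E : ℝ) = D)
    (hcard : Fintype.card ι = Module.finrank ℝ E + 1)
    (hv : ∀ i, ‖v i‖ = 1) (hG : ∀ i j, i ≠ j → ⟪v i, v j⟫_ℝ = -1 / D) (x : E) :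
    ∑ i, ⟪x, v i⟫_ℝ • v i = (1 + 1 / D) • x := by
  classical
  have hcard' : (Fintype.card ι : ℝ) = D + 1 := by rw [hcard, ← hfin]; push_cast; rfl
  have hx : x ∈ Submodule.span ℝ (Set.range v) := by
    rw [span_eq_top_of_gram hD hcard hv hG]
    trivial
  induction hx using Submodule.span_induction with
  | mem x hx =>
    obtain ⟨j, rfl⟩ := hx
    have h0 := sum_eq_zero_of_gram hD hcard' hv hG
    rw [← Finset.add_sum_erase _ _ (Finset.mem_univ j)] at h0 ⊢
    rw [real_inner_self_eq_norm_sq, hv,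
      Finset.sum_congr rfl fun i hi => by rw [hG j i (Finset.ne_of_mem_erase hi).symm],
      ← Finset.smul_sum, eq_neg_of_add_eq_zero_right h0]
    module
  | zero => simp
  | add x y _ _ hx hy => 
    rw [smul_add, ← hx, ← hy, ← Finset.sum_add_distrib]
    exact Finset.sum_congr rfl fun i _ => by rw [inner_add_left, add_smul]
  | smul a x _ hx =>
    simp_rw [real_inner_smul_left, mul_smul, ← Finset.smul_sum, hx]
    rw [smul_comm]

theorem sum_inner_sq_of_gram (hD : 0 < D) (hfin : (Module.finrank ℝ E : ℝ) = D)
    (hcard : Fintype.card ι = Module.finrank ℝ E + 1)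
    (hv : ∀ i, ‖v i‖ = 1) (hG : ∀ i j, i ≠ j → ⟪v i, v j⟫_ℝ = -1 / D) (x : E) :
    ∑ i, ⟪x, v i⟫_ℝ ^ 2 = (1 + 1 / D) * ‖x‖ ^ 2 := by
  have h := congrArg (fun z => ⟪x, z⟫_ℝ) (sum_inner_smul_eq_of_gram hD hfin hcard hv hG x)
  simp only [inner_sum, real_inner_smul_right, real_inner_self_eq_norm_sq] at h
  rw [← h]
  exact Finset.sum_congr rfl fun i _ => sq _

/-- Every permutation of the vertices of a regular simplex centred at the origin is induced by a
linear isometry. -/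
theorem exists_linearIsometryEquiv_of_gram (hD : 0 < D) (hfin : (Module.finrank ℝ E : ℝ) = D)
    (hcard : Fintype.card ι = Module.finrank ℝ E + 1)
    (hv : ∀ i, ‖v i‖ = 1) (hG : ∀ i j, i ≠ j → ⟪v i, v j⟫_ℝ = -1 / D) (σ : Equiv.Perm ι) :
    ∃ A : E ≃ₗᵢ[ℝ] E, ∀ i, A (v i) = v (σ i) := by
  classical
  have hcard' : (Fintype.card ι : ℝ) = D + 1 := by rw [hcard, ← hfin]; push_cast; rfl
  have hk : (1 + 1 / D) ≠ 0 := by positivity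
  have hvσ : ∀ i, ‖(v ∘ σ) i‖ = 1 := fun i => hv _
  have hGσ : ∀ i j, i ≠ j → ⟪(v ∘ σ) i, (v ∘ σ) j⟫_ℝ = -1 / D :=
    fun i j hij => hG _ _ (σ.injective.ne hij)
  -- The frame expansion of `x` with the output vectors permuted. Norms are preserved because the
  -- norm of a combination of the `v i` depends only on its coefficients through symmetric sums.
  let A : E →ₗ[ℝ] E :=
    (1 + 1 / D)⁻¹ • ∑ i, ((innerₗ E).flip (v i)).smulRight (v (σ i))
  have hA : ∀ x, A x = (1 + 1 / D)⁻¹ • ∑ i, ⟪x, v i⟫_ℝ • (v ∘ σ) i := by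
    intro x
    simp [A, real_inner_comm]
  have hnorm : ∀ x, ‖A x‖ = ‖x‖ := by
    intro x
    have h1 := norm_sq_sum_smul_of_gram hvσ hGσ fun i => ⟪x, v i⟫_ℝ
    rw [sum_inner_eq_zero_of_gram hD hcard' hv hG, sum_inner_sq_of_gram hD hfin hcard hv hG] at h1
    rw [← sq_eq_sq₀ (norm_nonneg _) (norm_nonneg _), hA, norm_smul, mul_pow, h1, Real.norm_eq_abs,
      sq_abs]
    field_simp
    ring
  refine ⟨LinearIsometry.toLinearIsometryEquiv ⟨A, hnorm⟩ rfl, fun j => ?_⟩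
  have h0 := sum_eq_zero_of_gram hD hcard' hvσ hGσ
  change A (v j) = v (σ j)
  rw [hA, inv_smul_eq_iff₀ hk]
  rw [← Finset.add_sum_erase _ _ (Finset.mem_univ j)] at h0 ⊢
  rw [real_inner_self_eq_norm_sq, hv,
    Finset.sum_congr rfl fun i hi => by rw [hG j i (Finset.ne_of_mem_erase hi).symm],
    ← Finset.smul_sum, eq_neg_of_add_eq_zero_right h0, Function.comp_apply]
  module

/-- Unit vectors, one more than the dimension, with a common pairwise inner product `c ≠ 1`:
the Gram matrix is singular, which determines `c`. -/
theorem inner_eq_of_constant_inner (hD : 0 < D) (hfin : (Module.finrank ℝ E : ℝ) = D)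
    (hcard : Fintype.card ι = Module.finrank ℝ E + 1) (hv : ∀ i, ‖v i‖ = 1) {c : ℝ} (hc : c ≠ 1)
    (hG : ∀ i j, i ≠ j → ⟪v i, v j⟫_ℝ = c) : c = -1 / D := by
  classical
  have hcard' : (Fintype.card ι : ℝ) = D + 1 := by rw [hcard, ← hfin]; push_cast; rfl
  obtain ⟨a, ha, k, hk⟩ := exists_nontrivial_sum_smul_eq_zero v (by omega)
  have hrel : ∀ j, a j * (1 - c) + c * ∑ i, a i = 0 := by
    intro j
    have h := congrArg (fun z => ⟪z, v j⟫_ℝ) ha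
    simp only [sum_inner, real_inner_smul_left, inner_zero_left] at h
    rw [← Finset.add_sum_erase _ _ (Finset.mem_univ j)] at h ⊢
    rw [real_inner_self_eq_norm_sq, hv,
      Finset.sum_congr rfl fun i hi => by rw [hG i j (Finset.ne_of_mem_erase hi)],
      ← Finset.sum_mul] at h
    linarith
  have hc' : 1 - c ≠ 0 := sub_ne_zero.2 hc.symm
  have hall : ∀ j, a j = a k := fun j =>
    mul_right_cancel₀ hc' (by linarith [hrel j, hrel k])
  have hk' := hrel k
  rw [Finset.sum_congr rfl fun i _ => hall i, Finset.sum_const, Finset.card_univ, nsmul_eq_mul,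
    hcard'] at hk'
  have : a k * (1 + c * D) = 0 := by linarith
  have := (mul_eq_zero.1 this).resolve_left hk
  rw [eq_div_iff hD.ne']
  linarith

/-- The interpolating quadratic becomes a polynomial of degree at most two in `⟪x, v i⟫`, whose sum
over `i` does not depend on the unit vector `x` by the moment identities. -/
theorem le_sum_apply_norm_sub_sq_of_gram {f : ℝ → ℝ} (hD : 1 < D)
    (hfin : (Module.finrank ℝ E : ℝ) = D)
    (hcard : Fintype.card ι = Module.finrank ℝ E + 1)
    (hv : ∀ i, ‖v i‖ = 1) (hG : ∀ i j, i ≠ j → ⟪v i, v j⟫_ℝ = -1 / D)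
    (hcont : ContinuousOn f (Set.Icc 0 4)) (hdiff : DifferentiableOn ℝ f (Set.Ioo 0 4))
    (hderiv : ConvexOn ℝ (Set.Ioo 0 4) (deriv f)) {x : E} (hx : ‖x‖ = 1) :
    f 0 + D * f (2 + 2 / D) ≤ ∑ i, f (‖x - v i‖ ^ 2) := by
  have hD0 : 0 < D := by linarith
  have hcard' : (Fintype.card ι : ℝ) = D + 1 := by rw [hcard, ← hfin]; push_cast; rfl
  obtain ⟨A, B, C, hle, h0, h1⟩ :=
    exists_quadratic_le (two_add_two_div_mem_Ioo hD) hcont hdiff hderiv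
  have hsum := Finset.sum_le_sum fun i (_ : i ∈ Finset.univ) =>
    hle _ (norm_sub_sq_mem_Icc hx (hv i))
  refine le_trans (le_of_eq ?_) hsum
  have hexp : ∀ i, A + B * ‖x - v i‖ ^ 2 + C * (‖x - v i‖ ^ 2) ^ 2 =
      (A + 2 * B + 4 * C) - (2 * B + 8 * C) * ⟪x, v i⟫_ℝ + 4 * C * ⟪x, v i⟫_ℝ ^ 2 := by
    intro i
    rw [norm_sub_sq_of_norm_eq_one hx (hv i)]
    ring
  simp_rw [hexp, Finset.sum_add_distrib, Finset.sum_sub_distrib, ← Finset.mul_sum]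
  rw [sum_inner_eq_zero_of_gram hD0 hcard' hv hG, sum_inner_sq_of_gram hD0 hfin hcard hv hG, hx,
    Finset.sum_const, Finset.card_univ, nsmul_eq_mul, hcard', h0, h1]
  field_simp
  ring

end SimplexGram

/-! ### Construction of a regular simplex. -/

section Existence

theorem exists_gram_simplex (d : ℕ) (hd : 0 < d) :
    ∃ v : Fin (d + 1) → EuclideanSpace ℝ (Fin d), (∀ i, ‖v i‖ = 1) ∧
      ∀ i j, i ≠ j → ⟪v i, v j⟫_ℝ = -1 / (d : ℝ) := by
  let u : EuclideanSpace ℝ (Fin (d + 1)) := WithLp.toLp 2 fun _ => 1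
  have hd' : (0 : ℝ) < d := by exact_mod_cast hd
  have hu : u ≠ 0 := by
    intro h
    have := congrArg (fun z : EuclideanSpace ℝ (Fin (d + 1)) => z 0) h
    simp [u] at this
  let e : Fin (d + 1) → EuclideanSpace ℝ (Fin (d + 1)) := fun i => EuclideanSpace.single i 1
  have hee : ∀ i j, ⟪e i, e j⟫_ℝ = if i = j then 1 else 0 := by
    intro i j
    simp [e, EuclideanSpace.inner_single_left, PiLp.single_apply]
  have heu : ∀ i, ⟪e i, u⟫_ℝ = 1 := by
    intro i
    simp [e, u, EuclideanSpace.inner_single_left]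
  have hue : ∀ i, ⟪u, e i⟫_ℝ = 1 := fun i => by rw [real_inner_comm, heu]
  have huu : ⟪u, u⟫_ℝ = d + 1 := by
    simp [u, EuclideanSpace.norm_sq_eq]
  have : Fact (Module.finrank ℝ (EuclideanSpace ℝ (Fin (d + 1))) = d + 1) := ⟨by simp⟩
  have hfin := Submodule.finrank_orthogonal_span_singleton (𝕜 := ℝ) (n := d) hu
  let Φ : (ℝ ∙ u)ᗮ ≃ₗᵢ[ℝ] EuclideanSpace ℝ (Fin d) :=
    (stdOrthonormalBasis ℝ (ℝ ∙ u)ᗮ).reindex (finCongr hfin) |>.repr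
  -- The standard basis projected onto the hyperplane orthogonal to the all-ones vector `u`; each
  -- projection has squared norm `d / (d + 1)`, hence the scaling.
  let w : Fin (d + 1) → EuclideanSpace ℝ (Fin (d + 1)) := fun i => √((d + 1) / d) • (e i - (1 / ((d : ℝ) + 1)) • u)
  have hwmem : ∀ i, w i ∈ (ℝ ∙ u)ᗮ := by
    intro i
    rw [Submodule.mem_orthogonal_singleton_iff_inner_right, real_inner_smul_right, inner_sub_right,
      real_inner_smul_right, hue, huu, one_div_mul_cancel (by positivity), sub_self, mul_zero]
  have hww : ∀ i j, ⟪w i, w j⟫_ℝ = (d + 1) / d * ((if i = j then 1 else 0) - 1 / ((d : ℝ) + 1)) := by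
    intro i j
    simp only [w, real_inner_smul_left, real_inner_smul_right, inner_sub_left, inner_sub_right, hee,
      heu, hue, huu]
    rw [one_div_mul_cancel (by positivity)]
    have hs := Real.mul_self_sqrt (show 0 ≤ ((d : ℝ) + 1) / d by positivity)
    linear_combination ((if i = j then 1 else 0) - 1 / ((d : ℝ) + 1)) * hs
  have hΦ : ∀ i j, ⟪Φ ⟨w i, hwmem i⟩, Φ ⟨w j, hwmem j⟩⟫_ℝ = ⟪w i, w j⟫_ℝ := by
    intro i j
    rw [LinearIsometryEquiv.inner_map_map]
    rfl
  refine ⟨fun i => Φ ⟨w i, hwmem i⟩, fun i => ?_, fun i j hij => ?_⟩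
  · rw [← sq_eq_sq₀ (norm_nonneg _) zero_le_one, ← real_inner_self_eq_norm_sq, hΦ, hww, if_pos rfl]
    field_simp
    ring
  · rw [hΦ, hww, if_neg hij]
    field_simp
    ring

end Existence

/-! ### Transfer to finite point sets on the sphere. -/

section Configurations

variable {d : ℕ} {ω : Finset (EuclideanSpace ℝ (Fin d))} {f : ℝ → ℝ}

theorem potential_eq_sum_coe (f : ℝ → ℝ) (ω : Finset (EuclideanSpace ℝ (Fin d)))
    (x : EuclideanSpace ℝ (Fin d)) :
    potential f ω x = ∑ v : ω, f (‖x - (v : EuclideanSpace ℝ (Fin d))‖ ^ 2) :=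
  (Finset.sum_coe_sort ω fun v => f (‖x - v‖ ^ 2)).symm

theorem IsSphereConfig.norm_eq_one (h : IsSphereConfig d ω) (v : ω) :
    ‖(v : EuclideanSpace ℝ (Fin d))‖ = 1 :=
  mem_sphere_zero_iff_norm.1 (h.1 v.2)

theorem IsSphereConfig.card_coe (h : IsSphereConfig d ω) :
    Fintype.card ω = Module.finrank ℝ (EuclideanSpace ℝ (Fin d)) + 1 := by
  rw [Fintype.card_coe, h.2, finrank_euclideanSpace_fin]

theorem IsInscribedRegularSimplex.isSphereConfig (h : IsInscribedRegularSimplex d ω) :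
    IsSphereConfig d ω := by
  obtain ⟨hsub, s, -, hrange⟩ := h
  refine ⟨hsub, ?_⟩
  rw [← Set.ncard_coe_finset, ← hrange, ← Set.image_univ,
    Set.ncard_image_of_injective _ s.independent.injective, Set.ncard_univ, Nat.card_fin]

/-- Equal edges between unit vectors give one common inner product, and `d + 1` vectors in dimension
`d` leave only `-1 / d` for it. -/
theorem IsInscribedRegularSimplex.inner_eq (hd : 0 < d) (h : IsInscribedRegularSimplex d ω)
    (u w : ω) (huw : u ≠ w) :
    ⟪(u : EuclideanSpace ℝ (Fin d)), (w : EuclideanSpace ℝ (Fin d))⟫_ℝ = -1 / (d : ℝ) := by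
  have hω := h.isSphereConfig
  obtain ⟨hsub, s, hreg, hrange⟩ := h
  obtain ⟨r, hr⟩ := hreg.equilateral
  have hdist : ∀ p q : ω, p ≠ q →
      ‖(p : EuclideanSpace ℝ (Fin d)) - (q : EuclideanSpace ℝ (Fin d))‖ = r := by
    intro p q hpq
    obtain ⟨i, hi⟩ : (p : EuclideanSpace ℝ (Fin d)) ∈ Set.range s.points := hrange ▸ p.2
    obtain ⟨j, hj⟩ : (q : EuclideanSpace ℝ (Fin d)) ∈ Set.range s.points := hrange ▸ q.2
    rw [← hi, ← hj, ← dist_eq_norm]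
    apply hr
    rintro rfl
    exact hpq (Subtype.ext (hi.symm.trans hj))
  have hin : ∀ p q : ω, p ≠ q →
      ⟪(p : EuclideanSpace ℝ (Fin d)), (q : EuclideanSpace ℝ (Fin d))⟫_ℝ = 1 - r ^ 2 / 2 := by
    intro p q hpq
    have := norm_sub_sq_of_norm_eq_one (hω.norm_eq_one p) (hω.norm_eq_one q)
    rw [hdist p q hpq] at this
    linarith
  have hr0 : 0 < r := by
    rw [← hdist u w huw, norm_pos_iff, sub_ne_zero]
    exact fun h => huw (Subtype.ext h)
  rw [hin u w huw]
  refine inner_eq_of_constant_inner (v := fun p : ω => (p : EuclideanSpace ℝ (Fin d)))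
    (by exact_mod_cast hd) (by rw [finrank_euclideanSpace_fin]) hω.card_coe hω.norm_eq_one ?_ hin
  have := pow_pos hr0 2
  linarith

theorem isInscribedRegularSimplex_of_gram (hd : 0 < d) {v : Fin (d + 1) → EuclideanSpace ℝ (Fin d)}
    (hv : ∀ i, ‖v i‖ = 1) (hG : ∀ i j, i ≠ j → ⟪v i, v j⟫_ℝ = -1 / (d : ℝ))
    (hω : Set.range v = (ω : Set (EuclideanSpace ℝ (Fin d)))) :
    IsInscribedRegularSimplex d ω := by
  have hd' : (0 : ℝ) < d := by exact_mod_cast hd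
  refine ⟨?_, ⟨v, affineIndependent_of_gram hd' hv hG⟩, fun σ => ?_, hω⟩
  · rw [← hω]
    rintro _ ⟨i, rfl⟩
    exact mem_sphere_zero_iff_norm.2 (hv i)
  -- `Regular` asks that every permutation of the vertices be induced by an isometry, which is more
  -- than equal edge lengths on its face.
  · obtain ⟨A, hA⟩ := exists_linearIsometryEquiv_of_gram hd' (by rw [finrank_euclideanSpace_fin])
      (by rw [finrank_euclideanSpace_fin, Fintype.card_fin]) hv hG σ
    exact ⟨A.toIsometryEquiv, funext fun i => (hA i).symm⟩

theorem IsSphereConfig.isInscribedRegularSimplex (hd : 0 < d) (h : IsSphereConfig d ω)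
    (hG : ∀ u w : ω, u ≠ w →
      ⟪(u : EuclideanSpace ℝ (Fin d)), (w : EuclideanSpace ℝ (Fin d))⟫_ℝ = -1 / (d : ℝ)) :
    IsInscribedRegularSimplex d ω := by
  let e := (ω.equivFinOfCardEq h.2).symm
  refine isInscribedRegularSimplex_of_gram hd (v := fun i => (e i : EuclideanSpace ℝ (Fin d)))
    (fun i => h.norm_eq_one _) (fun i j hij => hG _ _ (e.injective.ne hij)) ?_
  ext x
  refine ⟨?_, fun hx => ⟨e.symm ⟨x, hx⟩, by simp⟩⟩
  rintro ⟨i, rfl⟩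
  exact (e i).2

theorem exists_isInscribedRegularSimplex (hd : 0 < d) :
    ∃ ω : Finset (EuclideanSpace ℝ (Fin d)), IsInscribedRegularSimplex d ω := by
  classical
  obtain ⟨v, hv, hG⟩ := exists_gram_simplex d hd
  exact ⟨Finset.univ.image v, isInscribedRegularSimplex_of_gram hd hv hG (by simp)⟩

theorem isLeast_minPotential (hd : 0 < d) (hcont : ContinuousOn f (Set.Icc 0 4))
    (hω : IsSphereConfig d ω) :
    IsLeast (potential f ω '' Metric.sphere 0 1) (minPotential f ω) := by
  have : Nonempty (Fin d) := ⟨⟨0, hd⟩⟩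
  have hne : (Metric.sphere (0 : EuclideanSpace ℝ (Fin d)) 1).Nonempty :=
    NormedSpace.sphere_nonempty.2 zero_le_one
  have hc : ContinuousOn (potential f ω) (Metric.sphere 0 1) := by
    refine continuousOn_finsetSum ω fun v hv => hcont.comp (by fun_prop) fun x hx => ?_
    exact norm_sub_sq_mem_Icc (mem_sphere_zero_iff_norm.1 hx) (hω.norm_eq_one ⟨v, hv⟩)
  obtain ⟨m, hm⟩ := ((isCompact_sphere _ _).image_of_continuousOn hc).exists_isLeast (hne.image _)
  rwa [minPotential, hm.csInf_eq]

theorem IsInscribedRegularSimplex.minPotential_eq (hd : 2 ≤ d)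
    (hcont : ContinuousOn f (Set.Icc 0 4)) (hdiff : DifferentiableOn ℝ f (Set.Ioo 0 4))
    (hderiv : ConvexOn ℝ (Set.Ioo 0 4) (deriv f)) (h : IsInscribedRegularSimplex d ω) :
    minPotential f ω = f 0 + d * f (2 + 2 / d) := by
  have hω := h.isSphereConfig
  have hd0 : 0 < d := by omega
  have hD : (1 : ℝ) < d := by exact_mod_cast hd
  refine IsLeast.csInf_eq ⟨?_, ?_⟩
  · have : 0 < ω.card := by rw [hω.2]; omega
    obtain ⟨w, hw⟩ := Finset.card_pos.1 this
    refine ⟨w, hω.1 hw, ?_⟩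
    rw [potential_eq_sum_coe]
    exact sum_apply_norm_sub_sq_vertex_of_gram (v := fun p : ω => (p : EuclideanSpace ℝ (Fin d)))
      (by rw [Fintype.card_coe, hω.2]; push_cast; rfl) hω.norm_eq_one (h.inner_eq hd0) ⟨w, hw⟩
  · rintro _ ⟨x, hx, rfl⟩
    rw [potential_eq_sum_coe]
    exact le_sum_apply_norm_sub_sq_of_gram (v := fun p : ω => (p : EuclideanSpace ℝ (Fin d)))
      hD (by rw [finrank_euclideanSpace_fin]) hω.card_coe hω.norm_eq_one (h.inner_eq hd0) hcont
      hdiff hderiv (mem_sphere_zero_iff_norm.1 hx)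

theorem IsSphereConfig.minPotential_le (hd : 2 ≤ d) (hanti : AntitoneOn f (Set.Icc 0 4))
    (hconv : ConvexOn ℝ (Set.Ioc 0 4) f) (hcont : ContinuousOn f (Set.Icc 0 4))
    (hω : IsSphereConfig d ω) : minPotential f ω ≤ f 0 + d * f (2 + 2 / d) := by
  obtain ⟨x, hx, hle⟩ := exists_sum_apply_norm_sub_sq_le (D := d)
    (v := fun p : ω => (p : EuclideanSpace ℝ (Fin d))) (by exact_mod_cast hd)
    (by rw [finrank_euclideanSpace_fin]) hω.card_coe hω.norm_eq_one hanti hconv hcont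
  rw [← potential_eq_sum_coe] at hle
  exact ((isLeast_minPotential (by omega) hcont hω).2
    ⟨x, mem_sphere_zero_iff_norm.2 hx, rfl⟩).trans hle

theorem IsSphereConfig.isInscribedRegularSimplex_of_le_minPotential (hd : 2 ≤ d)
    (hanti : StrictAntiOn f (Set.Icc 0 4)) (hstrict : StrictConvexOn ℝ (Set.Ioc 0 4) f)
    (hcont : ContinuousOn f (Set.Icc 0 4)) (hω : IsSphereConfig d ω)
    (hle : f 0 + d * f (2 + 2 / d) ≤ minPotential f ω) : IsInscribedRegularSimplex d ω := by
  refine hω.isInscribedRegularSimplex (by omega) fun u w huw => ?_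
  refine inner_eq_of_forall_le_sum_apply_norm_sub_sq
    (v := fun p : ω => (p : EuclideanSpace ℝ (Fin d))) (by exact_mod_cast hd)
    (by rw [finrank_euclideanSpace_fin]) hω.card_coe hω.norm_eq_one hanti hstrict hcont
    (fun x hx => ?_) huw
  rw [← potential_eq_sum_coe]
  exact hle.trans ((isLeast_minPotential (by omega) hcont hω).2
    ⟨x, mem_sphere_zero_iff_norm.2 hx, rfl⟩)

end Configurations

theorem theorem2p2 (d : ℕ) (hd : 2 ≤ d) (f : ℝ → ℝ)
    (hanti : AntitoneOn f (Set.Ioc 0 4))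
    (hconv : ConvexOn ℝ (Set.Ioc 0 4) f)
    (hdiff : DifferentiableOn ℝ f (Set.Ioo 0 4))
    (hderiv : ConvexOn ℝ (Set.Ioo 0 4) (deriv f))
    (hlim : Filter.Tendsto f (nhdsWithin 0 (Set.Ioi 0)) (nhds (f 0))) :
    -- the minimum defining `P_f(ω, S^{d-1})` is attained for every configuration
    (∀ ω : Finset (EuclideanSpace ℝ (Fin d)), IsSphereConfig d ω →
      IsLeast (potential f ω '' Metric.sphere 0 1) (minPotential f ω)) ∧
    -- inscribed regular simplices exist, and they are configurations
    (∃ ω : Finset (EuclideanSpace ℝ (Fin d)), IsInscribedRegularSimplex d ω) ∧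
    (∀ ω : Finset (EuclideanSpace ℝ (Fin d)),
      IsInscribedRegularSimplex d ω → IsSphereConfig d ω) ∧
    -- they are optimal, and the optimal value
    (∀ ω' : Finset (EuclideanSpace ℝ (Fin d)), IsInscribedRegularSimplex d ω' →
      (∀ ω : Finset (EuclideanSpace ℝ (Fin d)), IsSphereConfig d ω →
        minPotential f ω ≤ minPotential f ω') ∧
      spherePolarization d f = minPotential f ω' ∧
      minPotential f ω' = f 0 + d * f (2 + 2 / d)) ∧
    -- uniqueness in the strictly convex case
    (StrictConvexOn ℝ (Set.Ioc 0 4) f →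
      ∀ ω' : Finset (EuclideanSpace ℝ (Fin d)), IsInscribedRegularSimplex d ω' →
        ∀ ω : Finset (EuclideanSpace ℝ (Fin d)), IsSphereConfig d ω →
          (minPotential f ω = minPotential f ω' ↔ IsInscribedRegularSimplex d ω)) := by
  have hcont := continuousOn_Icc_of_tendsto hanti hconv hdiff hlim
  have hanti' := antitoneOn_Icc_of_tendsto hanti hlim
  have hd0 : 0 < d := by omega
  refine ⟨fun ω hω => isLeast_minPotential hd0 hcont hω, exists_isInscribedRegularSimplex hd0,
    fun ω hω => hω.isSphereConfig, fun ω' hω' => ?_, fun hstrict ω' hω' ω hω => ?_⟩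
  · have hval := hω'.minPotential_eq hd hcont hdiff hderiv
    have hle : ∀ ω : Finset (EuclideanSpace ℝ (Fin d)), IsSphereConfig d ω →
        minPotential f ω ≤ minPotential f ω' := fun ω hω => by
      rw [hval]
      exact hω.minPotential_le hd hanti' hconv hcont
    refine ⟨hle, IsGreatest.csSup_eq ⟨⟨ω', hω'.isSphereConfig, rfl⟩, ?_⟩, hval⟩
    rintro _ ⟨ω, hω, rfl⟩
    exact hle ω hω
  · rw [hω'.minPotential_eq hd hcont hdiff hderiv]
    exact ⟨fun h => hω.isInscribedRegularSimplex_of_le_minPotential hd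
      (strictAntiOn_Icc_of_tendsto hanti hstrict hlim) hstrict hcont h.ge,
      fun h => h.minPotential_eq hd hcont hdiff hderiv⟩
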